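/- For integers $n,s$ let $K_n+\overline{K_s}$ denote the complete split graph, i.e. the graph obtained from the disjoint union of a complete graph $K_n$ on $n$ vertices and an edgeless graph $\overline{K_s}$ on $s$ vertices by joining every vertex of $K_n$ to every vertex of $\overline{K_s}$. For graphs $G$ and $H$, let $ar(G,H)$ be the maximum number $k$ such that there is an edge-coloring of $G$ with exactly $k$ colors in which no copy of $H$ in $G$ is rainbow (a subgraph is rainbow if all of its edges have different colors). If $2s\ge n\ge 4$, then $$ar(K_n+\overline{K_s},\,C_4)=\left\lfloor\frac{3n}{2}\right\rfloor+s-1,$$ where $C_4$ is the cycle on four vertices. -/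

import Mathlib

namespace SimpleGraph

/-- The join `G + H`: the disjoint union of `G` and `H` together with all edges between the two
vertex sets. -/
def graphJoin {V W : Type*} (G : SimpleGraph V) (H : SimpleGraph W) : SimpleGraph (V ⊕ W) :=
  (G ⊕g H) ⊔ completeBipartiteGraph V W

/-- The complete split graph: the join of the complete graph on `n` vertices and the empty
(edgeless) graph on `s` vertices. -/
def completeSplitGraph (n s : ℕ) : SimpleGraph (Fin n ⊕ Fin s) :=
  graphJoin (⊤ : SimpleGraph (Fin n)) (⊥ : SimpleGraph (Fin s))

/-- A copy of `H` in the edge-colored graph `G` is rainbow if its edges have pairwise different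
colors. -/
def IsRainbowCopy {V W K : Type*} {G : SimpleGraph V} {H : SimpleGraph W}
    (c : G.EdgeLabeling K) (f : H.Copy G) : Prop :=
  Function.Injective fun e : H.edgeSet => c (f.mapEdgeSet e)

/-- `k` is the anti-Ramsey number of `H` in `G`: the maximum `k` such that some edge-coloring of
`G` with exactly `k` colors (every color is used) has no rainbow copy of `H`. -/
def IsAntiRamseyNumber {V W : Type*} (G : SimpleGraph V) (H : SimpleGraph W) (k : ℕ) : Prop :=
  IsGreatest
    {m : ℕ | ∃ c : G.EdgeLabeling (Fin m),
      Function.Surjective c ∧ ∀ f : H.Copy G, ¬ IsRainbowCopy c f} k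

end SimpleGraph

namespace SimpleGraph

/-! Upper bound. One edge of each color forms a rainbow subgraph `R`. On a rainbow path starting in
the clique, the chord from the start across the first three edges closes a 4-cycle, so it repeats
one of their colors and can replace them. Hence every rainbow cycle is odd, and each of its vertices
lies on a rainbow triangle using only colors of the cycle. Two triangles at a common vertex with six
different colors force incompatible colors on a chord, so edge-disjoint cycles of `R` share no
vertex. Deleting one edge of a shortest cycle of `R` therefore destroys every cycle through its
vertices, at least two of which lie in the clique. After at most `⌊n/2⌋` deletions a forest remains,
so `R` has at most `(n + s - 1) + ⌊n/2⌋` edges (`ncard_edgeSet_le`).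

Lower bound. Since `n ≤ 2s`, there are `⌊n/2⌋` disjoint triangles, each with two clique vertices and
one independent vertex; the other vertices are singleton blocks. Triangle edges get private colors,
and an edge between blocks gets the smaller block index. A 4-cycle does not fit in one block, so it
enters and leaves its lowest block by edges of the same color. The `s + n % 2` blocks give `3⌊n/2⌋ +
s + n % 2 - 1` colors. -/

/-- `G` contains all edges meeting `K`, and no others. -/
def IsSplitAt {V : Type*} (G : SimpleGraph V) (K : Set V) : Prop :=
  ∀ u w, G.Adj u w ↔ u ≠ w ∧ (u ∈ K ∨ w ∈ K)

/-- No 4-cycle of `G` is rainbow for the coloring `col` of pairs of vertices. -/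
def NoRainbowFourCycle {V α : Type*} (G : SimpleGraph V) (col : Sym2 V → α) : Prop :=
  ∀ ⦃a b c d : V⦄, G.Adj a b → G.Adj b c → G.Adj c d → G.Adj d a → a ≠ c → b ≠ d →
    ¬ [col s(a, b), col s(b, c), col s(c, d), col s(d, a)].Nodup

/-! ### Rainbow paths, cycles and triangles in split graphs -/

section

variable {V α : Type*} {G : SimpleGraph V} {K : Set V} {col : Sym2 V → α}

/-- Replacing the first three edges by a chord keeps the path rainbow, its start in `K` and the
parity of its length. The start must lie in `K` for the chord to exist. -/
theorem exists_short_path (hG : G.IsSplitAt K) (h4 : G.NoRainbowFourCycle col) :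
    ∀ (n : ℕ) {u w : V} (p : G.Walk u w), p.length = n → u ∈ K → p.IsPath →
      (p.edges.map col).Nodup →
      ∃ q : G.Walk u w, q.IsPath ∧ q.length ≤ 2 ∧ q.length % 2 = p.length % 2 ∧
        (q.edges.map col).Nodup ∧ q.edges.map col ⊆ p.edges.map col := by
  intro n
  induction n using Nat.strong_induction_on with
  | _ n ih =>
    intro u w p hn hu hp hc
    by_cases hlen : p.length ≤ 2
    · exact ⟨p, hp, hlen, rfl, hc, fun _ h => h⟩
    match p, hn, hp, hc, hlen with
    | .nil, _, _, _, hlen => simp at hlen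
    | .cons _ .nil, _, _, _, hlen => simp at hlen
    | .cons _ (.cons _ .nil), _, _, _, hlen => simp at hlen
    | .cons (v := a) h1 (.cons (v := b) h2 (.cons (v := c) h3 r)), hn, hp, hc, _ =>
      have hp' := hp
      simp only [Walk.cons_isPath_iff, Walk.support_cons, List.mem_cons, not_or] at hp'
      obtain ⟨⟨⟨hr, hbr⟩, hab, har⟩, hua, hub, hur⟩ := hp'
      have hcr : c ∈ r.support := r.start_mem_support
      have huc : u ≠ c := fun h => hur (h ▸ hcr)
      have hac : a ≠ c := fun h => har (h ▸ hcr)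
      have hadj : G.Adj u c := (hG u c).2 ⟨huc, .inl hu⟩
      have hno := h4 h1 h2 h3 hadj.symm hub hac
      simp only [Walk.edges_cons, List.map_cons, List.nodup_cons, List.mem_cons, not_or] at hc
      have hmem : col s(u, c) = col s(u, a) ∨ col s(u, c) = col s(a, b) ∨
          col s(u, c) = col s(b, c) := by
        rw [Sym2.eq_swap (a := c)] at hno
        simp only [List.nodup_cons, List.mem_cons, not_or, List.not_mem_nil, List.nodup_nil] at hno
        grind
      -- The chord takes a color of one of the three removed edges, which does not recur on the rest
      -- of the path.
      have hnr : col s(u, c) ∉ r.edges.map col := by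
        rcases hmem with h | h | h <;> rw [h]
        · exact hc.1.2.2
        · exact hc.2.1.2
        · exact hc.2.2.1
      obtain ⟨q, hq, hq2, hqp, hqc, hqs⟩ := ih (r.length + 1) (by simp at hn; omega)
        (.cons hadj r) (by simp) hu ((Walk.cons_isPath_iff _ _).2 ⟨hr, hur⟩)
        (by simpa using ⟨by simpa using hnr, hc.2.2.2⟩)
      refine ⟨q, hq, hq2, ?_, hqc, fun x hx => ?_⟩
      · simp at hqp ⊢; omega
      · have := hqs hx
        simp only [Walk.edges_cons, List.map_cons, List.mem_cons] at this ⊢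
        rcases this with rfl | h
        · tauto
        · tauto

theorem color_mem_of_odd_path (hG : G.IsSplitAt K) (h4 : G.NoRainbowFourCycle col)
    {u w : V} (p : G.Walk u w) (hu : u ∈ K) (hp : p.IsPath) (hc : (p.edges.map col).Nodup)
    (hodd : p.length % 2 = 1) : col s(u, w) ∈ p.edges.map col := by
  obtain ⟨q, hq, hq2, hqp, hqc, hqs⟩ := exists_short_path hG h4 _ p rfl hu hp hc
  match q, hq2, hqp, hqs with
  | .nil, _, hqp, _ => simp at hqp; omega
  | .cons _ .nil, _, _, hqs => exact hqs (by simp)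
  | .cons _ (.cons _ .nil), _, hqp, _ => simp at hqp; omega
  | .cons _ (.cons _ (.cons _ _)), hq2, _, _ => simp at hq2

theorem exists_two_path (hG : G.IsSplitAt K) (h4 : G.NoRainbowFourCycle col)
    {u w : V} (p : G.Walk u w) (hu : u ∈ K) (hp : p.IsPath) (hc : (p.edges.map col).Nodup)
    (heven : p.length % 2 = 0) (huw : u ≠ w) :
    ∃ m, G.Adj u m ∧ G.Adj m w ∧ col s(u, m) ≠ col s(m, w) ∧
      col s(u, m) ∈ p.edges.map col ∧ col s(m, w) ∈ p.edges.map col := by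
  obtain ⟨q, hq, hq2, hqp, hqc, hqs⟩ := exists_short_path hG h4 _ p rfl hu hp hc
  match q, hq2, hqp, hqs, hqc with
  | .nil, _, hqp, _, _ => exact absurd rfl huw
  | .cons _ .nil, _, hqp, hqs, _ => simp at hqp; omega
  | .cons h1 (.cons h2 .nil), _, hqp, hqs, hqc =>
    exact ⟨_, h1, h2, by simpa using hqc, hqs (by simp), hqs (by simp)⟩
  | .cons _ (.cons _ (.cons _ _)), hq2, _, _, _ => simp at hq2

/-- A rainbow cycle has odd length, and yields a rainbow triangle through its base point that uses
only colors of the cycle. -/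
theorem exists_triangle_of_cycle (hG : G.IsSplitAt K) (h4 : G.NoRainbowFourCycle col)
    {v : V} (C : G.Walk v v) (hC : C.IsCycle) (hc : (C.edges.map col).Nodup) :
    C.length % 2 = 1 ∧ ∃ a m, G.Adj v a ∧ G.Adj a m ∧ G.Adj m v ∧
      [col s(v, a), col s(a, m), col s(m, v)].Nodup ∧
      [col s(v, a), col s(a, m), col s(m, v)] ⊆ C.edges.map col := by
  match C, hC, hc with
  | .nil, hC, _ => exact absurd hC Walk.not_isCycle_nil
  | .cons (v := a) h p, hC, hc =>
    obtain ⟨hp, -⟩ := (Walk.cons_isCycle_iff _ _).1 hC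
    simp only [Walk.edges_cons, List.map_cons, List.nodup_cons] at hc
    have hodd : p.length % 2 = 0 := by
      by_contra hne
      -- The edge `va` has an end in `K`; the rest of the cycle is traversed starting from that end.
      rcases ((hG v a).1 h).2 with hv | ha
      · apply hc.1
        have := color_mem_of_odd_path hG h4 p.reverse hv hp.reverse
          (by simpa using hc.2) (by simpa using hne)
        simpa using this
      · apply hc.1
        rw [Sym2.eq_swap]
        exact color_mem_of_odd_path hG h4 p ha hp hc.2 (by omega)
    refine ⟨by simp; omega, a, ?_⟩
    have key : ∃ m, G.Adj a m ∧ G.Adj m v ∧ col s(a, m) ≠ col s(m, v) ∧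
      col s(a, m) ∈ p.edges.map col ∧ col s(m, v) ∈ p.edges.map col := by
      rcases ((hG v a).1 h).2 with hv | ha
      · obtain ⟨m, h1, h2, h3, h5, h6⟩ := exists_two_path hG h4 p.reverse hv hp.reverse
          (by simpa using hc.2) (by simpa using hodd) h.ne
        refine ⟨m, h2.symm, h1.symm, ?_, ?_, ?_⟩
        · rw [Sym2.eq_swap (a := a), Sym2.eq_swap (a := m) (b := v)]; exact h3.symm
        · rw [Sym2.eq_swap]; simpa using h6
        · rw [Sym2.eq_swap]; simpa using h5
      · exact exists_two_path hG h4 p ha hp hc.2 hodd h.ne'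
    obtain ⟨m, h1, h2, h3, h5, h6⟩ := key
    refine ⟨m, h, h1, h2, ?_, ?_⟩
    · have ha : col s(v, a) ≠ col s(a, m) := fun e => hc.1 (e ▸ h5)
      have hb : col s(v, a) ≠ col s(m, v) := fun e => hc.1 (e ▸ h6)
      simp [ha, hb, h3]
    · intro x hx
      simp only [List.mem_cons, List.not_mem_nil, or_false] at hx
      simp only [Walk.edges_cons, List.map_cons, List.mem_cons]
      rcases hx with rfl | rfl | rfl <;> tauto

/-- The chord `ab` closes the 4-cycles `a b l v` and `a b v m`. Their remaining edges carry two
disjoint triples of distinct colors, and the color of `ab` would have to lie in both. -/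
theorem bowtie_aux (hG : G.IsSplitAt K) (h4 : G.NoRainbowFourCycle col)
    {v a m b l : V} (ha : a ∈ K) (hva : G.Adj v a) (ham : G.Adj a m) (hmv : G.Adj m v)
    (hvb : G.Adj v b) (hbl : G.Adj b l) (hlv : G.Adj l v)
    (hnd : [col s(v, a), col s(a, m), col s(m, v), col s(v, b), col s(b, l), col s(l, v)].Nodup) :
    False := by
  have hab : a ≠ b := by rintro rfl; simp at hnd
  have hal : a ≠ l := by rintro rfl; rw [Sym2.eq_swap (a := a) (b := v)] at hnd; simp at hnd
  have hmb : m ≠ b := by rintro rfl; rw [Sym2.eq_swap (a := m) (b := v)] at hnd; simp at hnd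
  have hadj : G.Adj a b := (hG a b).2 ⟨hab, .inl ha⟩
  have h1 := h4 hadj hbl hlv hva hal hvb.ne'
  have h2 := h4 hadj hvb.symm hmv.symm ham.symm hva.ne' hmb.symm
  rw [Sym2.eq_swap (a := b) (b := v), Sym2.eq_swap (a := v) (b := m),
    Sym2.eq_swap (a := m) (b := a)] at h2
  simp only [List.nodup_cons, List.mem_cons, not_or, List.not_mem_nil, List.nodup_nil] at hnd h1 h2
  grind

/-- Two rainbow triangles sharing a vertex have a common color. -/
theorem not_rainbow_bowtie (hG : G.IsSplitAt K) (h4 : G.NoRainbowFourCycle col)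
    {v a m b l : V} (hva : G.Adj v a) (ham : G.Adj a m) (hmv : G.Adj m v)
    (hvb : G.Adj v b) (hbl : G.Adj b l) (hlv : G.Adj l v)
    (hnd : [col s(v, a), col s(a, m), col s(m, v), col s(v, b), col s(b, l), col s(l, v)].Nodup) :
    False := by
  rcases ((hG a m).1 ham).2 with ha | hm
  · exact bowtie_aux hG h4 ha hva ham hmv hvb hbl hlv hnd
  · refine bowtie_aux hG h4 hm hmv.symm ham.symm hva.symm hvb hbl hlv ?_
    rw [Sym2.eq_swap (a := v) (b := m), Sym2.eq_swap (a := m) (b := a),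
      Sym2.eq_swap (a := a) (b := v)]
    simp only [List.nodup_cons, List.mem_cons, not_or, List.not_mem_nil, List.nodup_nil] at hnd ⊢
    grind

end


/-! ### How cycles of a rainbow subgraph meet -/

section

variable {V α : Type*} {G R : SimpleGraph V} {K : Set V} {col : Sym2 V → α}

theorem Walk.IsTrail.nodup_map_edges (hR : Set.InjOn col R.edgeSet) {u v : V} {p : R.Walk u v}
    (hp : p.IsTrail) : (p.edges.map col).Nodup :=
  hp.edges_nodup.map_on fun _ hx _ hy h =>
    hR (p.edges_subset_edgeSet hx) (p.edges_subset_edgeSet hy) h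

theorem exists_triangle_of_subgraph_cycle (hG : G.IsSplitAt K) (h4 : G.NoRainbowFourCycle col)
    (hRG : R ≤ G) (hR : Set.InjOn col R.edgeSet) {v : V} (C : R.Walk v v) (hC : C.IsCycle) :
    C.length % 2 = 1 ∧ ∃ a m, G.Adj v a ∧ G.Adj a m ∧ G.Adj m v ∧
      [col s(v, a), col s(a, m), col s(m, v)].Nodup ∧
      [col s(v, a), col s(a, m), col s(m, v)] ⊆ C.edges.map col := by
  have := exists_triangle_of_cycle hG h4 (C.mapLe hRG) (hC.mapLe hRG)
    (by rw [Walk.edges_mapLe_eq_edges]; exact hC.isTrail.nodup_map_edges hR)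
  rwa [Walk.edges_mapLe_eq_edges, Walk.length_mapLe] at this

theorem not_disjoint_edges_of_cycles (hG : G.IsSplitAt K) (h4 : G.NoRainbowFourCycle col)
    (hRG : R ≤ G) (hR : Set.InjOn col R.edgeSet) {v : V} (C D : R.Walk v v) (hC : C.IsCycle)
    (hD : D.IsCycle) (hCD : ∀ e ∈ D.edges, e ∉ C.edges) : False := by
  obtain ⟨-, a, m, h1, h2, h3, hn, hs⟩ := exists_triangle_of_subgraph_cycle hG h4 hRG hR C hC
  obtain ⟨-, b, l, h1', h2', h3', hn', hs'⟩ := exists_triangle_of_subgraph_cycle hG h4 hRG hR D hD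
  refine not_rainbow_bowtie hG h4 h1 h2 h3 h1' h2' h3' ?_
  have : ([col s(v, a), col s(a, m), col s(m, v)] ++
      [col s(v, b), col s(b, l), col s(l, v)]).Nodup := by
    refine List.nodup_append'.2 ⟨hn, hn', fun x hx hx' => ?_⟩
    obtain ⟨e, he, rfl⟩ := List.mem_map.1 (hs hx)
    obtain ⟨f, hf, hef⟩ := List.mem_map.1 (hs' hx')
    obtain rfl := hR (D.edges_subset_edgeSet hf) (C.edges_subset_edgeSet he) hef
    exact hCD _ hf he
  exact this

/-- A path joining two vertices of a cycle, disjoint from the cycle otherwise, closes up an even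
cycle if the given cycle is odd. -/
theorem Walk.IsCycle.exists_even_cycle [DecidableEq V] {u x y : V} {C : R.Walk u u}
    (hC : C.IsCycle) (hodd : C.length % 2 = 1) (hx : x ∈ C.support) (hy : y ∈ C.support)
    (hxy : x ≠ y) (Q : R.Walk x y) (hQ : Q.IsPath) (hQe : ∀ e ∈ Q.edges, e ∉ C.edges)
    (hQs : ∀ z ∈ Q.support, z ∈ C.support → z = x ∨ z = y) :
    ∃ (w : V) (D : R.Walk w w), D.IsCycle ∧ D.length % 2 = 0 := by
  have hrot := (Walk.isCycle_rotate hx).2 hC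
  have hy' : y ∈ (C.rotate x hx).support := (Walk.mem_support_rotate_iff C x hx).2 hy
  obtain ⟨A, B, hAB⟩ : ∃ (A : R.Walk x y) (B : R.Walk y x), A.append B = C.rotate x hx :=
    ⟨_, _, Walk.take_spec _ hy'⟩
  have hAnil : ¬ A.Nil := Walk.not_nil_of_ne hxy
  have hBnil : ¬ B.Nil := Walk.not_nil_of_ne hxy.symm
  rw [← hAB] at hrot
  have hA := hrot.isPath_of_append_left hBnil
  have hB := hrot.isPath_of_append_right hAnil
  have hlen : A.length + B.length = C.length := by
    rw [← Walk.length_append, hAB, Walk.length_rotate]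
  have hsupp : ∀ z, z ∈ A.support ∨ z ∈ B.support → z ∈ C.support := fun z hz => by
    rw [← Walk.mem_support_rotate_iff C x hx, ← hAB, Walk.mem_support_append_iff]; exact hz
  have hedge : ∀ e, e ∈ A.edges ∨ e ∈ B.edges → e ∈ C.edges := fun e he => by
    rw [← (Walk.rotate_edges C x hx).mem_iff, ← hAB, Walk.edges_append, List.mem_append]; exact he
  -- `Q` and an arc of `C` cannot both be the single edge `xy`, so gluing them gives a genuine
  -- cycle.
  have one_lt : ∀ P : R.Walk x y, (∀ e ∈ P.edges, e ∈ C.edges) → 1 < P.length ∨ 1 < Q.length := by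
    intro P hP
    by_contra! hcon
    have aux : ∀ T : R.Walk x y, T.length ≤ 1 → s(x, y) ∈ T.edges := by
      intro T hT
      match T, hT with
      | .nil, _ => exact absurd rfl hxy
      | .cons _ .nil, _ => simp
      | .cons _ (.cons _ _), hT => simp at hT
    exact hQe _ (aux Q hcon.2) (hP _ (aux P hcon.1))
  have tail_ne : ∀ {a b : V} (P : R.Walk a b), P.IsPath → ∀ z ∈ P.support.tail, z ≠ a := by
    rintro a b P hP z hz rfl
    have := hP.support_nodup
    rw [← Walk.cons_tail_support] at this
    exact (List.nodup_cons.1 this).1 hz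
  -- The arcs `A` and `B` have opposite parities because `C` is odd, so exactly one of them matches
  -- the parity of `Q`.
  by_cases hpar : A.length % 2 = Q.length % 2
  · refine ⟨x, A.append Q.reverse, hA.isCycle_append hQ.reverse ?_ ?_, ?_⟩
    · intro z hz hz'
      have h1 := hsupp z (.inl (List.mem_of_mem_tail hz))
      have h2 : z ∈ Q.support := by simpa using List.mem_of_mem_tail hz'
      rcases hQs z h2 h1 with rfl | rfl
      · exact tail_ne A hA _ hz rfl
      · exact tail_ne _ hQ.reverse _ hz' rfl
    · simpa using one_lt A fun e he => hedge e (.inl he)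
    · simp; omega
  · refine ⟨x, Q.append B, hQ.isCycle_append hB ?_ ?_, ?_⟩
    · intro z hz hz'
      have h1 := hsupp z (.inr (List.mem_of_mem_tail hz'))
      rcases hQs z (List.mem_of_mem_tail hz) h1 with rfl | rfl
      · exact tail_ne Q hQ _ hz rfl
      · exact tail_ne B hB _ hz' rfl
    · simpa using (one_lt B.reverse fun e he => hedge e (.inr (by simpa using he))).symm
    · simp; omega

/-- If all cycles are odd, then distinct vertices of a cycle are disconnected by deleting the edges
of the cycle. -/
theorem Walk.IsCycle.eq_of_reachable_deleteEdges
    (hodd : ∀ (w : V) (D : R.Walk w w), D.IsCycle → D.length % 2 = 1)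
    {u : V} {C : R.Walk u u} (hC : C.IsCycle) {x y : V} (hx : x ∈ C.support) (hy : y ∈ C.support)
    (hr : (R.deleteEdges {e | e ∈ C.edges}).Reachable x y) : x = y := by
  classical
  by_contra hxy
  have hex : ∃ n, ∃ x ∈ C.support, ∃ y ∈ C.support, x ≠ y ∧
      ∃ p : (R.deleteEdges {e | e ∈ C.edges}).Walk x y, p.IsPath ∧ p.length = n := by
    obtain ⟨p, hp⟩ := hr.exists_isPath
    exact ⟨_, x, hx, y, hy, hxy, p, hp, rfl⟩
  -- A shortest path over all pairs of distinct vertices of `C` has no interior vertex on `C`.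
  obtain ⟨x, hx, y, hy, hxy, p, hp, hn⟩ := Nat.find_spec hex
  have hmin := fun m => Nat.find_min (H := hex) (m := m)
  have hle : R.deleteEdges {e | e ∈ C.edges} ≤ R := deleteEdges_le _
  have hpe : ∀ e ∈ (p.mapLe hle).edges, e ∉ C.edges := by
    intro e he
    rw [Walk.edges_mapLe_eq_edges] at he
    have := p.edges_subset_edgeSet he
    rw [edgeSet_deleteEdges] at this
    exact this.2
  have hps : ∀ z ∈ (p.mapLe hle).support, z ∈ C.support → z = x ∨ z = y := by
    intro z hz hzC
    rw [Walk.support_mapLe_eq_support] at hz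
    by_contra! hne
    refine hmin (p.takeUntil z hz).length ?_
      ⟨x, hx, z, hzC, hne.1.symm, _, hp.takeUntil hz, rfl⟩
    rw [← hn]
    exact Walk.length_takeUntil_lt_length hz hne.2
  obtain ⟨w, D, hD, hD2⟩ := hC.exists_even_cycle (hodd _ C hC) hx hy hxy (p.mapLe hle)
    (hp.mapLe hle) hpe hps
  have := hodd w D hD
  omega

/-- In this and the next two lemmas, `E` and `S` stand for the edges and vertices of a cycle. A
first edge of `W` in `E` would start at a vertex of `S` in the component of `x`, that is at `x`
itself, where the path must already end. -/
theorem Walk.IsPath.edges_notMem_of_reachable {S : Set V} {E : Set (Sym2 V)}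
    (hE : ∀ a b, s(a, b) ∈ E → a ∈ S)
    (hS : ∀ x ∈ S, ∀ y ∈ S, (R.deleteEdges E).Reachable x y → x = y) {x : V} (hx : x ∈ S) :
    ∀ {z : V} (W : R.Walk z x), W.IsPath → (R.deleteEdges E).Reachable x z →
      ∀ e ∈ W.edges, e ∉ E
  | _, .nil, _, _ => by simp
  | z, .cons (v := w) h W, hW, hr => by
    have hzw : s(z, w) ∉ E := by
      intro hmem
      obtain rfl := hS x hx z (hE _ _ hmem) hr
      exact ((Walk.cons_isPath_iff _ _).1 hW).2 W.end_mem_support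
    have hadj : (R.deleteEdges E).Adj z w := deleteEdges_adj.2 ⟨h, hzw⟩
    have ih := Walk.IsPath.edges_notMem_of_reachable hE hS hx W hW.of_cons
      (hr.trans hadj.reachable)
    intro e he
    rw [Walk.edges_cons, List.mem_cons] at he
    rcases he with rfl | he
    · exact hzw
    · exact ih e he

/-- The component of `x` can be left only through an edge of `E`, and `x` is its only vertex in `S`.
-/
theorem Walk.start_mem_support_of_reachable {S : Set V} {E : Set (Sym2 V)}
    (hE : ∀ a b, s(a, b) ∈ E → a ∈ S)
    (hS : ∀ x ∈ S, ∀ y ∈ S, (R.deleteEdges E).Reachable x y → x = y) {x y : V} (hx : x ∈ S)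
    (hy : y ∈ S) :
    ∀ {z : V} (W : R.Walk z y), (R.deleteEdges E).Reachable x z → x ∈ W.support
  | _, .nil, hr => by simp [hS x hx _ hy hr]
  | z, .cons (v := w) h W, hr => by
    rw [Walk.support_cons, List.mem_cons]
    by_cases hzw : s(z, w) ∈ E
    · exact .inl (hS x hx z (hE _ _ hzw) hr)
    · have hadj : (R.deleteEdges E).Adj z w := deleteEdges_adj.2 ⟨h, hzw⟩
      exact .inr (Walk.start_mem_support_of_reachable hE hS hx hy W (hr.trans hadj.reachable))

/-- A step outside `E` stays in the component of `z`, so reaching `y` would require passing through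
`z` again. -/
theorem Walk.IsPath.edges_mem_of_mem {S : Set V} {E : Set (Sym2 V)}
    (hE : ∀ a b, s(a, b) ∈ E → a ∈ S)
    (hS : ∀ x ∈ S, ∀ y ∈ S, (R.deleteEdges E).Reachable x y → x = y) {y : V} (hy : y ∈ S) :
    ∀ {z : V} (W : R.Walk z y), W.IsPath → z ∈ S → ∀ e ∈ W.edges, e ∈ E
  | _, .nil, _, _ => by simp
  | z, .cons (v := w) h W, hW, hz => by
    have hzw : s(z, w) ∈ E := by
      by_contra hmem
      have hadj : (R.deleteEdges E).Adj z w := deleteEdges_adj.2 ⟨h, hmem⟩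
      exact ((Walk.cons_isPath_iff _ _).1 hW).2
        (Walk.start_mem_support_of_reachable hE hS hz hy W hadj.reachable)
    have ih := Walk.IsPath.edges_mem_of_mem hE hS hy W hW.of_cons
      (hE w z (Sym2.eq_swap ▸ hzw))
    intro e he
    rw [Walk.edges_cons, List.mem_cons] at he
    rcases he with rfl | he
    · exact hzw
    · exact ih e he

/-- The vertices of a shortest cycle of a rainbow subgraph lie on no cycle avoiding one of the edges
of that cycle. -/
theorem no_cycle_through_shortest (hG : G.IsSplitAt K) (h4 : G.NoRainbowFourCycle col)
    (hRG : R ≤ G) (hR : Set.InjOn col R.edgeSet) {u : V} (C : R.Walk u u) (hC : C.IsCycle)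
    (hmin : ∀ (w : V) (D : R.Walk w w), D.IsCycle → C.length ≤ D.length)
    {e : Sym2 V} (he : e ∈ C.edges) {v : V} (hv : v ∈ C.support) (D : R.Walk v v)
    (hD : D.IsCycle) (heD : e ∉ D.edges) : False := by
  classical
  have hodd : ∀ (w : V) (D : R.Walk w w), D.IsCycle → D.length % 2 = 1 := fun w D hD =>
    (exists_triangle_of_subgraph_cycle hG h4 hRG hR D hD).1
  have hE : ∀ a b, s(a, b) ∈ {e | e ∈ C.edges} → a ∈ {z | z ∈ C.support} := fun a b h =>
    C.fst_mem_support_of_mem_edges h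
  have hS : ∀ x ∈ {z | z ∈ C.support}, ∀ y ∈ {z | z ∈ C.support},
      (R.deleteEdges {e | e ∈ C.edges}).Reachable x y → x = y := fun x hx y hy hr =>
    hC.eq_of_reachable_deleteEdges hodd hx hy hr
  match D, hD, heD with
  | .nil, hD, _ => exact Walk.not_isCycle_nil hD
  | .cons (v := w) h W, hD, heD =>
    have hW := ((Walk.cons_isCycle_iff _ _).1 hD).1
    by_cases hvw : s(v, w) ∈ C.edges
    · have hmem := Walk.IsPath.edges_mem_of_mem hE hS hv W hW (hE w v (Sym2.eq_swap ▸ hvw))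
      have hsub : (Walk.cons h W).edges ⊆ C.edges.erase e := by
        intro f hf
        have hfe : f ≠ e := fun h => heD (h ▸ hf)
        refine (List.mem_erase_of_ne hfe).2 ?_
        rw [Walk.edges_cons, List.mem_cons] at hf
        rcases hf with rfl | hf
        · exact hvw
        · exact hmem f hf
      have h1 := (hD.isTrail.edges_nodup.subperm hsub).length_le
      rw [List.length_erase_of_mem he] at h1
      have h2 := hmin _ _ hD
      have h3 := List.length_pos_of_mem he
      simp only [Walk.length_edges] at h1 h3
      omega
    · have hadj : (R.deleteEdges {e | e ∈ C.edges}).Adj v w := deleteEdges_adj.2 ⟨h, hvw⟩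
      -- Here `D` and `C` are edge-disjoint cycles through `v`.
      have hnot := Walk.IsPath.edges_notMem_of_reachable hE hS hv W hW hadj.reachable
      refine not_disjoint_edges_of_cycles hG h4 hRG hR (C.rotate v hv) _
        ((Walk.isCycle_rotate hv).2 hC) hD fun f hf => ?_
      rw [(Walk.rotate_edges C v hv).mem_iff]
      rw [Walk.edges_cons, List.mem_cons] at hf
      rcases hf with rfl | hf
      · exact hvw
      · exact hnot f hf

end


/-! ### Counting edges and colors -/

section

variable {V α : Type*} {G R : SimpleGraph V} {K : Set V} {col : Sym2 V → α}

theorem IsAcyclic.ncard_edgeSet_lt [Finite V] [Nonempty V] (hR : R.IsAcyclic) :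
    R.edgeSet.ncard + 1 ≤ Nat.card V := by
  classical
  have := Fintype.ofFinite V
  obtain ⟨T, hRT, hT⟩ := exists_maximal_isAcyclic_of_le_isAcyclic (le_top : R ≤ ⊤) hR
  have hT' : T.IsTree := maximal_isAcyclic_iff_isTree.1
    ⟨hT.prop.2, fun H hH hTH => hT.le_of_ge ⟨le_top, hH⟩ hTH⟩
  have h1 := hT'.card_edgeFinset
  have h2 : R.edgeSet.ncard ≤ T.edgeSet.ncard :=
    Set.ncard_le_ncard (edgeSet_mono hRT) (Set.toFinite _)
  rw [← coe_edgeFinset T, Set.ncard_coe_finset] at h2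
  rw [Nat.card_eq_fintype_card]
  omega

/-- The vertices of `K` lying on a cycle of `R`. -/
def cyclicVertices (R : SimpleGraph V) (K : Set V) : Set V :=
  {u | u ∈ K ∧ ∃ C : R.Walk u u, C.IsCycle}

/-- Vertices outside `K` are pairwise nonadjacent, so among two consecutive vertices of a cycle at
least one is in `K`. -/
theorem Walk.IsCycle.exists_two_mem (hG : G.IsSplitAt K) (hRG : R ≤ G) {u : V} {C : R.Walk u u}
    (hC : C.IsCycle) : ∃ x ∈ C.support, ∃ y ∈ C.support, x ≠ y ∧ x ∈ K ∧ y ∈ K := by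
  classical
  have base : ∀ {v : V} (D : R.Walk v v), D.IsCycle → v ∈ K →
      ∃ x ∈ D.support, ∃ y ∈ D.support, x ≠ y ∧ x ∈ K ∧ y ∈ K := by
    intro v D hD hv
    match D, hD with
    | .nil, hD => exact absurd hD Walk.not_isCycle_nil
    | .cons h .nil, _ => exact absurd h (R.loopless.irrefl _)
    | .cons (v := a) h (.cons (v := b) h' p), hD =>
      by_cases ha : a ∈ K
      · exact ⟨v, by simp, a, by simp, h.ne, hv, ha⟩
      · have hb := ((hG a b).1 (hRG h')).2.resolve_left ha
        refine ⟨v, by simp, b, by simp, ?_, hv, hb⟩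
        rintro rfl
        exact ((Walk.cons_isCycle_iff _ _).1 hD).2 (by simp [Sym2.eq_swap])
  match C, hC with
  | .nil, hC => exact absurd hC Walk.not_isCycle_nil
  | .cons (v := a) h p, hC =>
    by_cases hu : u ∈ K
    · exact base _ hC hu
    · have ha := ((hG u a).1 (hRG h)).2.resolve_left hu
      have hmem : a ∈ (Walk.cons h p).support := by simp
      obtain ⟨x, hx, y, hy, hxy⟩ := base _ ((Walk.isCycle_rotate hmem).2 hC) ha
      exact ⟨x, (Walk.mem_support_rotate_iff _ _ _).1 hx, y,
        (Walk.mem_support_rotate_iff _ _ _).1 hy, hxy⟩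

/-- Induction on the number of edges: removing an edge of a shortest cycle takes at least two
vertices out of `cyclicVertices`, which pays for that edge. Forests are the terminal case. -/
theorem ncard_edgeSet_le [Finite V] [Nonempty V] (hG : G.IsSplitAt K)
    (h4 : G.NoRainbowFourCycle col) :
    ∀ (n : ℕ) (R : SimpleGraph V), R.edgeSet.ncard = n → R ≤ G → Set.InjOn col R.edgeSet →
      R.edgeSet.ncard + 1 ≤ Nat.card V + (R.cyclicVertices K).ncard / 2 := by
  classical
  intro n
  induction n with
  | zero => intro R hn _ _; have := Nat.card_pos (α := V); omega
  | succ n ih =>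
    intro R hn hRG hR
    by_cases hac : R.IsAcyclic
    · have := hac.ncard_edgeSet_lt; omega
    obtain ⟨u, C, hC, hg⟩ := exists_girth_eq_length.2 hac
    have hmin : ∀ (w : V) (D : R.Walk w w), D.IsCycle → C.length ≤ D.length := fun w D hD =>
      hg ▸ girth_le_length hD
    obtain ⟨e, he⟩ : ∃ e, e ∈ C.edges :=
      List.exists_mem_of_ne_nil _ (by simpa [Walk.edges_eq_nil] using hC.not_nil)
    have heR := C.edges_subset_edgeSet he
    have hle : R.deleteEdges {e} ≤ R := deleteEdges_le _
    have hcard : (R.deleteEdges {e}).edgeSet.ncard = n := by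
      rw [edgeSet_deleteEdges, Set.ncard_sdiff_singleton_of_mem heR, hn, Nat.add_sub_cancel]
    have key := ih (R.deleteEdges {e}) hcard (hle.trans hRG) (hR.mono (edgeSet_mono hle))
    obtain ⟨x, hx, y, hy, hxy, hxK, hyK⟩ := hC.exists_two_mem hG hRG
    have hnot : ∀ v ∈ C.support, v ∉ (R.deleteEdges {e}).cyclicVertices K := by
      rintro v hv ⟨-, D, hD⟩
      refine no_cycle_through_shortest hG h4 hRG hR C hC hmin he hv (D.mapLe hle) (hD.mapLe hle) ?_
      rw [Walk.edges_mapLe_eq_edges]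
      intro hmem
      have := D.edges_subset_edgeSet hmem
      rw [edgeSet_deleteEdges] at this
      exact this.2 rfl
    have hsub : insert x (insert y ((R.deleteEdges {e}).cyclicVertices K)) ⊆
        R.cyclicVertices K := by
      rintro z (rfl | rfl | ⟨hz, D, hD⟩)
      · exact ⟨hxK, C.rotate _ hx, (Walk.isCycle_rotate hx).2 hC⟩
      · exact ⟨hyK, C.rotate _ hy, (Walk.isCycle_rotate hy).2 hC⟩
      · exact ⟨hz, D.mapLe hle, hD.mapLe hle⟩
    have h1 := Set.ncard_le_ncard hsub (Set.toFinite _)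
    rw [Set.ncard_insert_of_notMem (by simp [hxy, hnot x hx]) (Set.toFinite _),
      Set.ncard_insert_of_notMem (hnot y hy) (Set.toFinite _)] at h1
    omega

/-- The injection `φ` lets one statement serve both bounds: `Option.some` for the upper bound,
`Fin.val` for the construction. -/
theorem isRainbowCopy_cycleGraph_four_iff {κ β : Type*} {c : G.EdgeLabeling κ} {φ : κ → β}
    (hφ : Function.Injective φ) {d : Sym2 V → β} (hd : ∀ e : G.edgeSet, d e = φ (c e))
    (f : (cycleGraph 4).Copy G) :
    IsRainbowCopy c f ↔
      [d s(f 0, f 1), d s(f 1, f 2), d s(f 2, f 3), d s(f 3, f 0)].Nodup := by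
  have h01 : s((0 : Fin 4), 1) ∈ (cycleGraph 4).edgeSet := by rw [mem_edgeSet]; decide
  have h12 : s((1 : Fin 4), 2) ∈ (cycleGraph 4).edgeSet := by rw [mem_edgeSet]; decide
  have h23 : s((2 : Fin 4), 3) ∈ (cycleGraph 4).edgeSet := by rw [mem_edgeSet]; decide
  have h30 : s((3 : Fin 4), 0) ∈ (cycleGraph 4).edgeSet := by rw [mem_edgeSet]; decide
  have hval : ∀ (i j : Fin 4) (h : s(i, j) ∈ (cycleGraph 4).edgeSet),
      φ (c (f.mapEdgeSet ⟨s(i, j), h⟩)) = d s(f i, f j) := fun i j h => (hd _).symm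
  have hinj : IsRainbowCopy c f ↔
      Function.Injective fun e : (cycleGraph 4).edgeSet => φ (c (f.mapEdgeSet e)) :=
    (hφ.of_comp_iff _).symm
  rw [hinj]
  constructor
  · intro h
    have ne : ∀ {i j k l : Fin 4} (h1 : s(i, j) ∈ (cycleGraph 4).edgeSet)
        (h2 : s(k, l) ∈ (cycleGraph 4).edgeSet), s(i, j) ≠ s(k, l) →
        d s(f i, f j) ≠ d s(f k, f l) := by
      intro i j k l h1 h2 hne heq
      rw [← hval i j h1, ← hval k l h2] at heq
      exact hne (congrArg Subtype.val (h heq))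
    have n1 := ne h01 h12 (by decide)
    have n2 := ne h01 h23 (by decide)
    have n3 := ne h01 h30 (by decide)
    have n4 := ne h12 h23 (by decide)
    have n5 := ne h12 h30 (by decide)
    have n6 := ne h23 h30 (by decide)
    simp [n1, n2, n3, n4, n5, n6]
  · intro hnd
    have hcases : ∀ e : (cycleGraph 4).edgeSet, e = ⟨s(0, 1), h01⟩ ∨ e = ⟨s(1, 2), h12⟩ ∨
        e = ⟨s(2, 3), h23⟩ ∨ e = ⟨s(3, 0), h30⟩ := by
      rintro ⟨e, he⟩
      simp only [Subtype.mk.injEq]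
      induction e using Sym2.ind with
      | _ i j =>
        rw [mem_edgeSet] at he
        revert i j
        decide
    simp only [List.nodup_cons, List.mem_cons, not_or, List.not_mem_nil, List.nodup_nil] at hnd
    intro e e' hee
    rcases hcases e with rfl | rfl | rfl | rfl <;> rcases hcases e' with rfl | rfl | rfl | rfl <;>
      first
      | rfl
      | (simp only [hval] at hee; grind)

/-- A coloring of a split graph on clique `K` without rainbow 4-cycle has at most
`|V| + ⌊|K| / 2⌋ - 1` colors. -/
theorem colors_le_of_not_rainbow [Finite V] [Nonempty V] (hG : G.IsSplitAt K) {m : ℕ}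
    (c : G.EdgeLabeling (Fin m)) (hc : Function.Surjective c)
    (hf : ∀ f : (cycleGraph 4).Copy G, ¬ IsRainbowCopy c f) :
    m + 1 ≤ Nat.card V + K.ncard / 2 := by
  classical
  let d : Sym2 V → Option (Fin m) := fun e => if h : e ∈ G.edgeSet then some (c ⟨e, h⟩) else none
  have hd : ∀ e : G.edgeSet, d e = some (c e) := fun e => dif_pos e.2
  have h4 : G.NoRainbowFourCycle d := by
    intro x y z w hxy hyz hzw hwx hxz hyw
    let g : cycleGraph 4 →g G :=
      { toFun := ![x, y, z, w]
        map_rel' := by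
          intro i j hij
          have h0 : ∀ i j : Fin 4, (cycleGraph 4).Adj i j → j = i + 1 ∨ i = j + 1 := by decide
          have h1 : ∀ i : Fin 4, G.Adj (![x, y, z, w] i) (![x, y, z, w] (i + 1)) := by
            intro i
            fin_cases i
            exacts [hxy, hyz, hzw, hwx]
          rcases h0 i j hij with rfl | rfl
          · exact h1 i
          · exact (h1 j).symm }
    have hg : Function.Injective g := by
      have h5 : [x, y, z, w].Nodup := by
        simp [hxy.ne, hxz, hwx.ne', hyz.ne, hyw, hzw.ne]
      intro i j hij
      change ![x, y, z, w] i = ![x, y, z, w] j at hij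
      simp only [List.nodup_cons, List.mem_cons, not_or, List.not_mem_nil, List.nodup_nil] at h5
      fin_cases i <;> fin_cases j <;> simp at hij ⊢ <;> grind
    exact fun hnd => hf ⟨g, hg⟩
      ((isRainbowCopy_cycleGraph_four_iff (Option.some_injective _) hd ⟨g, hg⟩).2 hnd)
  choose e he using hc
  let R : SimpleGraph V := fromEdgeSet (Set.range fun i => (e i : Sym2 V))
  have hRe : R.edgeSet = Set.range fun i => (e i : Sym2 V) := by
    rw [edgeSet_fromEdgeSet, sdiff_eq_left, Set.disjoint_left]
    rintro _ ⟨i, rfl⟩ h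
    exact G.not_isDiag_of_mem_edgeSet (e i).2 h
  have hinj : Function.Injective fun i => (e i : Sym2 V) := by
    intro i j hij
    rw [← he i, ← he j, Subtype.ext hij]
  have hRG : R ≤ G := by
    rw [← edgeSet_subset_edgeSet, hRe]
    rintro _ ⟨i, rfl⟩
    exact (e i).2
  have hR : Set.InjOn d R.edgeSet := by
    rw [hRe]
    rintro _ ⟨i, rfl⟩ _ ⟨j, rfl⟩ hij
    simp only [hd, he, Option.some.injEq] at hij
    rw [hij]
  have hcard : R.edgeSet.ncard = m := by
    rw [hRe, ← Set.image_univ, Set.ncard_image_of_injective _ hinj]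
    simp
  have h1 := ncard_edgeSet_le hG h4 m R hcard hRG hR
  have h2 : (R.cyclicVertices K).ncard ≤ K.ncard :=
    Set.ncard_le_ncard (fun _ h => h.1) (Set.toFinite _)
  have := Nat.div_le_div_right (c := 2) h2
  omega

end


/-! ### The extremal coloring -/

theorem completeSplitGraph_isSplitAt (n s : ℕ) :
    (completeSplitGraph n s).IsSplitAt (Set.range Sum.inl) := by
  rintro (i | i) (j | j) <;> simp [completeSplitGraph, graphJoin]

/-- The index of the block (a triangle, or a single vertex) containing a vertex, for a partition of
the complete split graph into `n / 2` triangles and single vertices; the single independent vertices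
come first. -/
def blockIndex (n s : ℕ) : Fin n ⊕ Fin s → ℕ
  | .inl i => (s - n / 2) + i / 2
  | .inr j => if (j : ℕ) < n / 2 then (s - n / 2) + j else j - n / 2

/-- The position of a vertex in its block. -/
def blockPosition (n s : ℕ) : Fin n ⊕ Fin s → ℕ
  | .inl i => 1 + i % 2
  | .inr _ => 0

/-- Edges between different blocks get the smaller block index as color, edges within a block get
colors of their own. -/
def blockColor (n s : ℕ) : Sym2 (Fin n ⊕ Fin s) → ℕ :=
  Sym2.lift ⟨fun x y => if blockIndex n s x = blockIndex n s y then
      -- Two positions in a triangle sum to 1, 2 or 3, so private colors start at `s + n % 2 - 1`,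
      -- just after the colors used between blocks.
      (s + n % 2 - 2) + 3 * (blockIndex n s x - (s - n / 2)) +
        (blockPosition n s x + blockPosition n s y)
    else min (blockIndex n s x) (blockIndex n s y), fun x y => by
      by_cases h : blockIndex n s x = blockIndex n s y
      · simp [h, add_comm]
      · simp [h, Ne.symm h, min_comm]⟩

theorem blockColor_mk (n s : ℕ) (x y : Fin n ⊕ Fin s) :
    blockColor n s s(x, y) = if blockIndex n s x = blockIndex n s y then
      (s + n % 2 - 2) + 3 * (blockIndex n s x - (s - n / 2)) +
        (blockPosition n s x + blockPosition n s y)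
    else min (blockIndex n s x) (blockIndex n s y) := rfl

variable {n s : ℕ}

theorem blockIndex_le (hn : 4 ≤ n) (hs : n ≤ 2 * s) (x : Fin n ⊕ Fin s) :
    blockIndex n s x ≤ s + n % 2 - 1 := by
  rcases x with i | j
  · have := i.2; simp only [blockIndex]; omega
  · have := j.2; simp only [blockIndex]; split_ifs <;> omega

theorem blockColor_lt (hn : 4 ≤ n) (hs : n ≤ 2 * s) {e : Sym2 (Fin n ⊕ Fin s)}
    (he : e ∈ (completeSplitGraph n s).edgeSet) : blockColor n s e < 3 * n / 2 + s - 1 := by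
  induction e using Sym2.ind with
  | _ x y =>
    rw [mem_edgeSet, completeSplitGraph_isSplitAt n s x y] at he
    rw [blockColor_mk]
    split_ifs with h
    · obtain ⟨hxy, -⟩ := he
      rcases x with i | i <;> rcases y with j | j <;>
        simp only [blockIndex, blockPosition, ne_eq, Sum.inl.injEq, Sum.inr.injEq, Fin.ext_iff]
          at h hxy ⊢ <;> have := i.2 <;> have := j.2 <;> (try split_ifs at h ⊢) <;> omega
    · have := blockIndex_le hn hs x
      have := blockIndex_le hn hs y
      omega

theorem not_forall_blockIndex_eq {x y z w : Fin n ⊕ Fin s}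
    (hd : [x, y, z, w].Nodup) (h1 : blockIndex n s x = blockIndex n s y)
    (h2 : blockIndex n s x = blockIndex n s z) (h3 : blockIndex n s x = blockIndex n s w) :
    False := by
  have inj : ∀ u v : Fin n ⊕ Fin s, blockIndex n s u = blockIndex n s v →
      blockPosition n s u = blockPosition n s v → u = v := by
    rintro (i | i) (j | j) h h' <;>
      simp only [blockIndex, blockPosition, Sum.inl.injEq, Sum.inr.injEq, Fin.ext_iff] at h h' ⊢ <;>
      have := i.2 <;> have := j.2 <;> (try split_ifs at h) <;> omega
  have lt : ∀ u : Fin n ⊕ Fin s, blockPosition n s u < 3 := by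
    rintro (i | i) <;> simp only [blockPosition] <;> omega
  simp only [List.nodup_cons, List.mem_cons, not_or, List.not_mem_nil, List.nodup_nil] at hd
  obtain ⟨⟨n1, n2, n3, -⟩, ⟨n4, n5, -⟩, ⟨n6, -⟩, -⟩ := hd
  have m1 : blockPosition n s x ≠ blockPosition n s y := fun h => n1 (inj x y h1 h)
  have m2 : blockPosition n s x ≠ blockPosition n s z := fun h => n2 (inj x z h2 h)
  have m3 : blockPosition n s x ≠ blockPosition n s w := fun h => n3 (inj x w h3 h)
  have m4 : blockPosition n s y ≠ blockPosition n s z := fun h => n4 (inj y z (h1.symm.trans h2) h)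
  have m5 : blockPosition n s y ≠ blockPosition n s w := fun h => n5 (inj y w (h1.symm.trans h3) h)
  have m6 : blockPosition n s z ≠ blockPosition n s w := fun h => n6 (inj z w (h2.symm.trans h3) h)
  have := lt x
  have := lt y
  have := lt z
  have := lt w
  omega

/-- A maximal run of vertices of minimal index along the cycle is bounded by two different edges,
both colored by that minimum. -/
theorem not_nodup_of_eq_min {r₁ r₂ r₃ r₄ c₁ c₂ c₃ c₄ : ℕ} (h₁ : r₁ ≠ r₂ → c₁ = min r₁ r₂)
    (h₂ : r₂ ≠ r₃ → c₂ = min r₂ r₃) (h₃ : r₃ ≠ r₄ → c₃ = min r₃ r₄) (h₄ : r₄ ≠ r₁ → c₄ = min r₄ r₁)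
    (hne : ¬ (r₁ = r₂ ∧ r₁ = r₃ ∧ r₁ = r₄)) : ¬ [c₁, c₂, c₃, c₄].Nodup := by
  intro hnd
  simp only [List.nodup_cons, List.mem_cons, not_or, List.not_mem_nil, List.nodup_nil] at hnd
  obtain ⟨⟨n1, n2, n3, -⟩, ⟨n4, n5, -⟩, ⟨n6, -⟩, -⟩ := hnd
  omega

theorem not_nodup_blockColor {x y z w : Fin n ⊕ Fin s}
    (hd : [x, y, z, w].Nodup) :
    ¬ [blockColor n s s(x, y), blockColor n s s(y, z), blockColor n s s(z, w),
      blockColor n s s(w, x)].Nodup := by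
  have key : ∀ u v : Fin n ⊕ Fin s, blockIndex n s u ≠ blockIndex n s v →
      blockColor n s s(u, v) = min (blockIndex n s u) (blockIndex n s v) := fun u v h => by
    rw [blockColor_mk, if_neg h]
  exact not_nodup_of_eq_min (key x y) (key y z) (key z w) (key w x)
    fun h => not_forall_blockIndex_eq hd h.1 h.2.1 h.2.2

theorem exists_blockColor_eq (hn : 4 ≤ n) (hs : n ≤ 2 * s) {k : ℕ} (hk : k < 3 * n / 2 + s - 1) :
    ∃ e ∈ (completeSplitGraph n s).edgeSet, blockColor n s e = k := by
  suffices h : ∃ x y, x ≠ y ∧ (x ∈ Set.range Sum.inl ∨ y ∈ Set.range Sum.inl) ∧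
      blockColor n s s(x, y) = k by
    obtain ⟨x, y, hxy, h, hk⟩ := h
    exact ⟨s(x, y), (mem_edgeSet _).2 ((completeSplitGraph_isSplitAt n s x y).2 ⟨hxy, h⟩), hk⟩
  have hl : ∀ i (h : i < n), blockIndex n s (.inl ⟨i, h⟩) = s - n / 2 + i / 2 := fun _ _ => rfl
  have hr : ∀ j (h : j < s), j < n / 2 → blockIndex n s (.inr ⟨j, h⟩) = s - n / 2 + j :=
    fun _ _ h => if_pos h
  -- The clique vertex `n - 1` lies in the last block, so its edge to a vertex of block `k` has
  -- color `k`; this serves the two ranges of colors used between blocks.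
  by_cases hk1 : k < s - n / 2
  · refine ⟨.inl ⟨n - 1, by omega⟩, .inr ⟨n / 2 + k, by omega⟩, by simp, by simp, ?_⟩
    have h : blockIndex n s (.inr ⟨n / 2 + k, by omega⟩) = n / 2 + k - n / 2 := if_neg (by simp)
    rw [blockColor_mk, h, hl, if_neg (by omega)]
    omega
  by_cases hk2 : k < s + n % 2 - 1
  · refine ⟨.inl ⟨n - 1, by omega⟩, .inl ⟨2 * (k - (s - n / 2)), by omega⟩, ?_, by simp, ?_⟩
    · simp only [ne_eq, Sum.inl.injEq, Fin.mk.injEq]; omega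
    rw [blockColor_mk, hl, hl, if_neg (by omega)]
    omega
  obtain ⟨i, t, ht, hi⟩ : ∃ i t, t < 3 ∧ k = s + n % 2 - 1 + 3 * i + t :=
    ⟨(k - (s + n % 2 - 1)) / 3, (k - (s + n % 2 - 1)) % 3, by omega, by omega⟩
  have hin : i < n / 2 := by omega
  have ht3 : t = 0 ∨ t = 1 ∨ t = 2 := by omega
  rcases ht3 with rfl | rfl | rfl
  · refine ⟨.inl ⟨2 * i, by omega⟩, .inr ⟨i, by omega⟩, by simp, by simp, ?_⟩
    rw [blockColor_mk, hl, hr _ _ hin, if_pos (by omega)]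
    simp only [blockPosition]
    omega
  · refine ⟨.inl ⟨2 * i + 1, by omega⟩, .inr ⟨i, by omega⟩, by simp, by simp, ?_⟩
    rw [blockColor_mk, hl, hr _ _ hin, if_pos (by omega)]
    simp only [blockPosition]
    omega
  · refine ⟨.inl ⟨2 * i, by omega⟩, .inl ⟨2 * i + 1, by omega⟩, by simp, by simp, ?_⟩
    rw [blockColor_mk, hl, hl, if_pos (by omega)]
    simp only [blockPosition]
    omega

end SimpleGraph

open SimpleGraph in
theorem corollary1 (n s : ℕ) (hn : 4 ≤ n) (hs : n ≤ 2 * s) :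
    SimpleGraph.IsAntiRamseyNumber (SimpleGraph.completeSplitGraph n s)
      (SimpleGraph.cycleGraph 4) (3 * n / 2 + s - 1) := by
  constructor
  · refine ⟨fun e => ⟨blockColor n s e, blockColor_lt hn hs e.2⟩, fun k => ?_, fun f hf => ?_⟩
    · obtain ⟨e, he, hek⟩ := exists_blockColor_eq hn hs k.2
      exact ⟨⟨e, he⟩, Fin.ext hek⟩
    · refine not_nodup_blockColor ?_ ((isRainbowCopy_cycleGraph_four_iff
        (d := blockColor n s) Fin.val_injective (fun _ => rfl) f).1 hf)
      have hne : ∀ i j : Fin 4, i ≠ j → f i ≠ f j := fun i j h h' => h (f.injective h')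
      simp [hne]
  · rintro m ⟨c, hc, hf⟩
    have : Nonempty (Fin n ⊕ Fin s) := ⟨.inl ⟨0, by omega⟩⟩
    have h := colors_le_of_not_rainbow (completeSplitGraph_isSplitAt n s) c hc hf
    have hK : (Set.range (Sum.inl : Fin n → Fin n ⊕ Fin s)).ncard = n := by
      rw [← Set.image_univ, Set.ncard_image_of_injective _ Sum.inl_injective]
      simp
    rw [hK, Nat.card_eq_fintype_card, Fintype.card_sum, Fintype.card_fin, Fintype.card_fin] at h
    omega
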